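/- **Proposition (Maximum Principle).** Let $n\ge 3$ and let $(M^n,g)$ be a smooth Riemannian manifold with boundary $\partial M$. Let $\Delta_g$ be the Laplace–Beltrami operator, $\partial/\partial\eta$ the outward-pointing unit normal derivative on $\partial M$, and $h_g$ the mean curvature of $\partial M$ (the average of the principal curvatures with respect to the outward normal, with the sign for which the unit ball of $\mathbb R^n$ has $h=1$). Assume that $h_g>0$ on $\partial M$, and let $\lambda,\gamma>0$ be constants. Let $M_1\subseteq M$ be a compact piece of $M$ containing $\partial M$, with smooth boundary $\partial M_1=\partial M\cup N$; that is, $M_1$ is a compact neighborhood of $\partial M$ whose topological frontier in $M$ is a (possibly empty) smooth hypersurface $N$, with $M_1$ locally on one side of $N$. Suppose that the function $u$ is $C^1$ on $M_1$ (up to and including the boundary), is $C^2$ in the interior $M_1\setminus(\partial M\cup N)$, and satisfies $$\begin{cases}\Delta_g u-\lambda u\ \ge\ 0 & \text{in } M_1\setminus(\partial M\cup N),\\[2pt] \dfrac{\partial u}{\partial\eta}+\Big(\dfrac{n-2}{2}\,h_g+\gamma\Big)u\ \le\ 0 & \text{on }\partial M,\\[2pt] u\ \le\ 0 & \text{on }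 N.\end{cases}$$ Then $u\le 0$ on $M_1$. -/

import Mathlib

open scoped Manifold ContDiff Topology

noncomputable section

namespace YamabeBoundary

/-- Smooth Riemannian metrics on an `n`-dimensional manifold with boundary `M`
(modelled on the half space `{y | 0 ≤ y 0}` of `ℝⁿ`). -/
abbrev Metric (n : ℕ) [NeZero n] (M : Type*) [TopologicalSpace M]
    [ChartedSpace (EuclideanHalfSpace n) M] [IsManifold (𝓡∂ n) ∞ M] :=
  Bundle.ContMDiffRiemannianMetric (IB := 𝓡∂ n) (n := ∞) (F := EuclideanSpace ℝ (Fin n))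
    (E := fun x : M => TangentSpace (𝓡∂ n) x)

/-- The `i`-th partial derivative of a function on the closed half space `{y | 0 ≤ y 0}`.
At points of the bounding hyperplane the derivative is the one-sided one (taken within the
half space); at the other points of the half space it is the usual partial derivative. -/
def partialDeriv {n : ℕ} [NeZero n] (i : Fin n) (f : EuclideanSpace ℝ (Fin n) → ℝ)
    (y : EuclideanSpace ℝ (Fin n)) : ℝ :=
  fderivWithin ℝ f (Set.range (𝓡∂ n)) y (EuclideanSpace.single i 1)

section Metric

variable {n : ℕ} [NeZero n] {M : Type*} [TopologicalSpace M]
  [ChartedSpace (EuclideanHalfSpace n) M] [IsManifold (𝓡∂ n) ∞ M]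

/-- The coordinate vector field `∂/∂yᵢ` of the preferred chart at `x₀`, at the point of `M` with
coordinates `y`: the push-forward of the `i`-th basis vector by the inverse of the chart. -/
def coordVector (x₀ : M) (i : Fin n) (y : EuclideanSpace ℝ (Fin n)) :
    TangentSpace (𝓡∂ n) ((extChartAt (𝓡∂ n) x₀).symm y) :=
  mfderivWithin 𝓘(ℝ, EuclideanSpace ℝ (Fin n)) (𝓡∂ n) (extChartAt (𝓡∂ n) x₀).symm
    (Set.range (𝓡∂ n)) y (EuclideanSpace.single i (1 : ℝ) : EuclideanSpace ℝ (Fin n))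

/-- The matrix `(g_ij)` of the metric in the preferred chart at `x₀`, as a function of the
coordinates `y`. -/
def metricMatrix (g : Metric n M) (x₀ : M) (y : EuclideanSpace ℝ (Fin n)) :
    Matrix (Fin n) (Fin n) ℝ :=
  Matrix.of fun i j =>
    g.inner ((extChartAt (𝓡∂ n) x₀).symm y) (coordVector x₀ i y) (coordVector x₀ j y)

/-- The matrix `(g_ij)` at the point `x`, in the preferred chart at `x`. -/
def metricAt (g : Metric n M) (x : M) : Matrix (Fin n) (Fin n) ℝ :=
  metricMatrix g x (extChartAt (𝓡∂ n) x x)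

/-- The Christoffel symbol `Γᵏ_ij` of the Levi-Civita connection at the point `x`, in the
preferred chart at `x`:
`Γᵏ_ij = ½ ∑ₗ gᵏˡ (∂ᵢ g_jl + ∂ⱼ g_il - ∂ₗ g_ij)`. -/
def christoffel (g : Metric n M) (x : M) (k i j : Fin n) : ℝ :=
  let y₀ := extChartAt (𝓡∂ n) x x
  (1 / 2) * ∑ l, (metricAt g x)⁻¹ k l *
    (partialDeriv i (fun y => metricMatrix g x y j l) y₀
      + partialDeriv j (fun y => metricMatrix g x y i l) y₀
      - partialDeriv l (fun y => metricMatrix g x y i j) y₀)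

/-- The Laplace-Beltrami operator (the trace of the covariant Hessian) in the preferred chart:
`Δ_g u = ∑ᵢⱼ gⁱʲ (∂ᵢ∂ⱼ u - ∑ₖ Γᵏ_ij ∂ₖ u)`. -/
def laplacian (g : Metric n M) (u : M → ℝ) (x : M) : ℝ :=
  let y₀ := extChartAt (𝓡∂ n) x x
  let v : EuclideanSpace ℝ (Fin n) → ℝ := fun y => u ((extChartAt (𝓡∂ n) x).symm y)
  ∑ i, ∑ j, (metricAt g x)⁻¹ i j *
    (partialDeriv i (partialDeriv j v) y₀ - ∑ k, christoffel g x k i j * partialDeriv k v y₀)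

/-- The outward-pointing unit normal `η` at a boundary point `x`. The manifold is
`{y | 0 ≤ y 0}` in the chart, so `η = - ∇y₀ / |∇y₀|`, that is `ηⁱ = - gⁱ⁰ / √g⁰⁰`.
It is given by its components in the preferred chart at `x`; these are also its description as
an element of `TangentSpace (𝓡∂ n) x`, which is `ℝⁿ` through that chart. -/
def outwardNormal (g : Metric n M) (x : M) : EuclideanSpace ℝ (Fin n) :=
  WithLp.toLp 2 fun i => -((metricAt g x)⁻¹ i 0) / Real.sqrt ((metricAt g x)⁻¹ 0 0)

/-- The outward normal derivative `∂u/∂η` at a boundary point `x`. -/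
def normalDeriv (g : Metric n M) (u : M → ℝ) (x : M) : ℝ :=
  (mfderiv (𝓡∂ n) 𝓘(ℝ, ℝ) u x : EuclideanSpace ℝ (Fin n) →L[ℝ] ℝ) (outwardNormal g x)

/-- The second fundamental form `II(∂ₐ, ∂_b) = - g(∇_{∂ₐ} ∂_b, η)` of the boundary at a boundary
point `x`, with respect to the outward unit normal `η`
(`∂ₐ`, `∂_b` are tangent to the boundary when `a, b ≠ 0`). -/
def secondFundamentalForm (g : Metric n M) (x : M) (a b : Fin n) : ℝ :=
  -∑ k, ∑ l, metricAt g x k l * christoffel g x k a b *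
    outwardNormal g x l

/-- The mean curvature `h_g` of the boundary at a boundary point: the average of the principal
curvatures, `h_g = (1 / (n - 1)) ∑ σᵃᵇ II_ab`, where `σ` is the metric induced on the boundary.
The signs are such that the unit ball of `ℝⁿ` has `h = 1`. -/
def meanCurvature (g : Metric n M) (x : M) : ℝ :=
  let σ : Matrix {i : Fin n // i ≠ 0} {i : Fin n // i ≠ 0} ℝ :=
    (metricAt g x).submatrix Subtype.val Subtype.val
  (1 / ((n : ℝ) - 1)) * ∑ a, ∑ b, σ⁻¹ a b * secondFundamentalForm g x a.1 b.1

/-- The operator `L_λ u = Δ_g u - λ u`. -/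
def opL (g : Metric n M) (lam : ℝ) (u : M → ℝ) (x : M) : ℝ :=
  laplacian g u x - lam * u x

/-- The boundary operator `B_γ u = ∂u/∂η + ((n - 2)/2 h_g + γ) u`. -/
def opB (g : Metric n M) (γ : ℝ) (u : M → ℝ) (x : M) : ℝ :=
  normalDeriv g u x + (((n : ℝ) - 2) / 2 * meanCurvature g x + γ) * u x

end Metric

/-- `M₁ ⊆ M` is a compact piece of `M` containing `∂M`, with smooth boundary `∂M₁ = ∂M ∪ N`:
`M₁` is a compact neighbourhood of `∂M`, and `N`, the part of its boundary other than `∂M`,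
is the topological frontier of `M₁` in `M` and is a smooth hypersurface (possibly empty), with
`M₁` locally on one side of it. -/
structure IsCompactPiece (n : ℕ) [NeZero n] {M : Type*} [TopologicalSpace M]
    [ChartedSpace (EuclideanHalfSpace n) M] (M₁ N : Set M) : Prop where
  isCompact : IsCompact M₁
  boundary_subset : (𝓡∂ n).boundary M ⊆ interior M₁
  frontier_eq : frontier M₁ = N
  smooth : ∀ p ∈ N, ∃ U ∈ 𝓝 p, ∃ ρ : M → ℝ, ContMDiffOn (𝓡∂ n) 𝓘(ℝ, ℝ) ∞ ρ U ∧
    mfderiv (𝓡∂ n) 𝓘(ℝ, ℝ) ρ p ≠ 0 ∧ ∀ q ∈ U, q ∈ M₁ ↔ ρ q ≤ 0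

end YamabeBoundary

end

/-! If `u` were positive somewhere, its maximum over the compact set `M₁` would be positive and
attained off `N`, hence at a local maximum of `u` on `M`. At an interior point of `M` this forces
`Δ_g u ≤ 0`, so `Δ_g u - λ u < 0`. On `∂M` it forces `∂u/∂η ≥ 0`, and the coefficient of `u` is
positive, so the boundary expression is positive. Both contradict the hypotheses; neither the Hopf
lemma nor the strong maximum principle is needed. The two sign facts are
`laplacian_nonpos_of_isLocalMax` and `normalDeriv_nonneg_of_isLocalMax`; of the metric they use only
that the inverse matrix is positive semidefinite. -/

open Matrix in
theorem YamabeBoundary.metricMatrix_posSemidef {n : ℕ} [NeZero n] {M : Type*} [TopologicalSpace M]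
    [ChartedSpace (EuclideanHalfSpace n) M] [IsManifold (𝓡∂ n) ∞ M]
    (g : YamabeBoundary.Metric n M) (x₀ : M) (y : EuclideanSpace ℝ (Fin n)) :
    (YamabeBoundary.metricMatrix g x₀ y).PosSemidef := by
  refine Matrix.PosSemidef.of_dotProduct_mulVec_nonneg ?_ fun v => ?_
  · ext i j
    simp only [Matrix.conjTranspose_apply, metricMatrix, Matrix.of_apply, star_trivial]
    exact g.symm _ _ _
  · set p := (extChartAt (𝓡∂ n) x₀).symm y
    -- A Gram matrix: its quadratic form is the squared `g`-length of a combination of coordinate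
    -- vectors.
    have key : star v ⬝ᵥ (metricMatrix g x₀ y) *ᵥ v
        = g.inner p (∑ i, v i • coordVector x₀ i y) (∑ i, v i • coordVector x₀ i y) := by
      simp only [map_sum, map_smul, _root_.sum_apply, _root_.smul_apply,
        dotProduct, mulVec, metricMatrix, Matrix.of_apply, Pi.star_apply, star_trivial,
        smul_eq_mul, Finset.mul_sum]
      rw [Finset.sum_comm]
      refine Finset.sum_congr rfl fun i _ => Finset.sum_congr rfl fun j _ => ?_
      ring
    rw [key]
    by_cases h : (∑ i, v i • coordVector x₀ i y) = 0
    · rw [h]; simp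
    · exact (g.pos p _ h).le

/-- At a local maximum, the second derivative in any direction is nonpositive. -/
theorem IsLocalMax.fderiv_fderiv_apply_nonpos {E : Type*} [NormedAddCommGroup E] [NormedSpace ℝ E]
    {f : E → ℝ} {y : E} (hf : ContDiffAt ℝ 2 f y) (h : IsLocalMax f y) (b : E) :
    fderiv ℝ (fderiv ℝ f) y b b ≤ 0 := by
  have hline : ∀ t : ℝ, HasDerivAt (fun t : ℝ => y + t • b) b t := fun t => by
    simpa using ((hasDerivAt_id t).smul_const b).const_add y
  have hcont : Filter.Tendsto (fun t : ℝ => y + t • b) (𝓝 0) (𝓝 y) := by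
    simpa using (hline 0).continuousAt.tendsto
  have hd : ∀ᶠ z in 𝓝 y, DifferentiableAt ℝ f z :=
    (hf.eventually (by simp)).mono fun z hz => hz.differentiableAt (by simp)
  have hderiv : deriv (fun t : ℝ => f (y + t • b)) =ᶠ[𝓝 0] fun t => fderiv ℝ f (y + t • b) b :=
    (hcont.eventually hd).mono fun t ht => (ht.hasFDerivAt.comp_hasDerivAt t (hline t)).deriv
  have hd2 : DifferentiableAt ℝ (fderiv ℝ f) y :=
    (hf.fderiv_right (m := 1) (by norm_num)).differentiableAt (by simp)
  have hderiv2 : deriv (deriv fun t : ℝ => f (y + t • b)) 0 = fderiv ℝ (fderiv ℝ f) y b b := by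
    rw [hderiv.deriv_eq]
    have h2 : HasFDerivAt (fderiv ℝ f) (fderiv ℝ (fderiv ℝ f) y) (y + (0 : ℝ) • b) := by
      simpa using hd2.hasFDerivAt
    have h3 : HasDerivAt (fun t : ℝ => fderiv ℝ f (y + t • b)) (fderiv ℝ (fderiv ℝ f) y b) 0 :=
      h2.comp_hasDerivAt (0 : ℝ) (hline 0)
    have h4 := h3.clm_apply (hasDerivAt_const (0 : ℝ) b)
    rw [map_zero, add_zero] at h4
    exact h4.deriv
  have hmax : IsLocalMax (fun t : ℝ => f (y + t • b)) 0 := by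
    have := hcont.eventually h
    simpa [IsLocalMax, IsMaxFilter] using this
  by_contra! hpos
  -- A positive second derivative would make `0` a local minimum too, so `f` would be constant near
  -- `y` along the line and that derivative would vanish.
  have hmin : IsLocalMin (fun t : ℝ => f (y + t • b)) 0 := by
    refine isLocalMin_of_deriv_deriv_pos (by rw [hderiv2]; exact hpos) hmax.deriv_eq_zero ?_
    have := hf.continuousAt.tendsto.comp hcont
    simpa [ContinuousAt, Function.comp_def] using this
  have hconst : (fun t : ℝ => f (y + t • b)) =ᶠ[𝓝 0] fun _ => f (y + (0 : ℝ) • b) := by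
    filter_upwards [hmax, hmin] with t h1 h2 using le_antisymm h1 h2
  have : deriv (deriv fun t : ℝ => f (y + t • b)) 0 = 0 := by
    rw [hconst.deriv.deriv_eq]; simp
  rw [hderiv2] at this
  exact hpos.ne' this

/-- The trace of the product of a positive semidefinite matrix with the matrix of a nonpositive
bilinear form is nonpositive. -/
theorem Matrix.PosSemidef.sum_mul_apply_nonpos {ι : Type*} [Fintype ι] [DecidableEq ι]
    {A : Matrix ι ι ℝ} (hA : A.PosSemidef) {E : Type*} [AddCommGroup E] [Module ℝ E]
    (H : E →ₗ[ℝ] E →ₗ[ℝ] ℝ) (hH : ∀ b, H b b ≤ 0) (e : ι → E) :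
    ∑ i, ∑ j, A i j * H (e i) (e j) ≤ 0 := by
  -- This factorization turns the trace into a sum of diagonal values `H w w`, one for each row of
  -- `B`.
  obtain ⟨B, rfl⟩ : ∃ B : Matrix ι ι ℝ, A = B.conjTranspose * B := by
    open scoped MatrixOrder in
    exact CStarAlgebra.nonneg_iff_eq_star_mul_self.mp hA.nonneg
  have key : ∑ i, ∑ j, (B.conjTranspose * B) i j * H (e i) (e j)
      = ∑ k, H (∑ i, B k i • e i) (∑ j, B k j • e j) := by
    simp only [map_sum, map_smul, LinearMap.sum_apply, LinearMap.smul_apply, smul_eq_mul,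
      Matrix.mul_apply, Matrix.conjTranspose_apply, star_trivial, Finset.sum_mul, Finset.mul_sum]
    rw [Finset.sum_comm' (t' := Finset.univ) (s' := fun _ => Finset.univ) (by simp),
      Finset.sum_congr rfl fun j _ => Finset.sum_comm, Finset.sum_comm]
    refine Finset.sum_congr rfl fun k _ => Finset.sum_congr rfl fun i _ =>
      Finset.sum_congr rfl fun j _ => ?_
    ring
  rw [key]
  exact Finset.sum_nonpos fun k _ => hH _

namespace YamabeBoundary

variable {n : ℕ} [NeZero n] {M : Type*} [TopologicalSpace M]
  [ChartedSpace (EuclideanHalfSpace n) M]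

/-- A local maximum of a function on `M` is, in the chart, a local maximum within the half
space. -/
theorem isLocalMaxOn_comp_extChartAt_symm {u : M → ℝ} {x : M} (h : IsLocalMax u x) :
    IsLocalMaxOn (fun y => u ((extChartAt (𝓡∂ n) x).symm y)) (Set.range (𝓡∂ n))
      (extChartAt (𝓡∂ n) x x) := by
  have hc : Filter.Tendsto (extChartAt (𝓡∂ n) x).symm
      (𝓝[Set.range (𝓡∂ n)] (extChartAt (𝓡∂ n) x x)) (𝓝 x) := by
    simpa only [extChartAt_to_inv] using
      (continuousAt_extChartAt_symm (I := 𝓡∂ n) x).tendsto.mono_left nhdsWithin_le_nhds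
  have := hc.eventually h
  simpa only [IsLocalMaxOn, IsMaxFilter, extChartAt_to_inv] using this

theorem partialDeriv_eventuallyEq_fderiv {f : EuclideanSpace ℝ (Fin n) → ℝ}
    {y : EuclideanSpace ℝ (Fin n)} (hy : Set.range (𝓡∂ n) ∈ 𝓝 y) (i : Fin n) :
    partialDeriv i f =ᶠ[𝓝 y] fun z => fderiv ℝ f z (EuclideanSpace.single i 1) := by
  filter_upwards [eventually_mem_nhds_iff.mpr hy] with z hz
  rw [partialDeriv, fderivWithin_of_mem_nhds hz]

variable [IsManifold (𝓡∂ n) ∞ M]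

/-- The gradient vanishes at the maximum, which kills the Christoffel terms; what remains is the
trace of `g⁻¹` against a nonpositive Hessian. -/
theorem laplacian_nonpos_of_isLocalMax (g : Metric n M) {u : M → ℝ} {x : M}
    (hx : (𝓡∂ n).IsInteriorPoint x) (hu : ContMDiffAt (𝓡∂ n) 𝓘(ℝ, ℝ) 2 u x)
    (h : IsLocalMax u x) : laplacian g u x ≤ 0 := by
  have hr : Set.range (𝓡∂ n) ∈ 𝓝 (extChartAt (𝓡∂ n) x x) := range_mem_nhds_isInteriorPoint hx
  have hmax := (isLocalMaxOn_comp_extChartAt_symm (n := n) h).isLocalMax hr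
  have hv : ContDiffAt ℝ 2 (fun y => u ((extChartAt (𝓡∂ n) x).symm y))
      (extChartAt (𝓡∂ n) x x) := by
    have := (contMDiffAt_iff.mp hu).2
    simp only [extChartAt_model_space_eq_id, PartialEquiv.refl_coe, Function.id_comp] at this
    exact this.contDiffAt hr
  simp only [laplacian]
  set v : EuclideanSpace ℝ (Fin n) → ℝ := fun y => u ((extChartAt (𝓡∂ n) x).symm y)
  set y₀ := extChartAt (𝓡∂ n) x x
  have h1 : ∀ k, partialDeriv k v y₀ = 0 := fun k => by
    rw [(partialDeriv_eventuallyEq_fderiv hr k).self_of_nhds]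
    simp only [hmax.fderiv_eq_zero, _root_.zero_apply]
  have hd2 : DifferentiableAt ℝ (fderiv ℝ v) y₀ :=
    (hv.fderiv_right (m := 1) (by norm_num)).differentiableAt (by simp)
  have h2 : ∀ i j, partialDeriv i (partialDeriv j v) y₀
      = fderiv ℝ (fderiv ℝ v) y₀ (EuclideanSpace.single i 1) (EuclideanSpace.single j 1) := by
    intro i j
    rw [(partialDeriv_eventuallyEq_fderiv hr i).self_of_nhds]
    beta_reduce
    rw [(partialDeriv_eventuallyEq_fderiv hr j).fderiv_eq,
      fderiv_clm_apply hd2 (differentiableAt_const _)]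
    simp
  simp only [h1, h2, mul_zero, Finset.sum_const_zero, sub_zero]
  exact (metricMatrix_posSemidef g x y₀).inv.sum_mul_apply_nonpos
    (ContinuousLinearMap.coeLM ℝ ∘ₗ (fderiv ℝ (fderiv ℝ v) y₀).toLinearMap)
    (fun b => hmax.fderiv_fderiv_apply_nonpos hv b) fun i => EuclideanSpace.single i 1

/-- Since `g⁰⁰ ≥ 0`, the vector `-η` points into the half space, and one-sided derivatives in such
directions are nonpositive at a maximum. -/
theorem normalDeriv_nonneg_of_isLocalMax (g : Metric n M) {u : M → ℝ} {x : M}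
    (hu : MDifferentiableAt (𝓡∂ n) 𝓘(ℝ, ℝ) u x) (h : IsLocalMax u x) :
    0 ≤ normalDeriv g u x := by
  set y₀ := extChartAt (𝓡∂ n) x x
  have hy₀ : 0 ≤ y₀ 0 := by
    have : y₀ ∈ Set.range (𝓡∂ n) := Set.mem_range_self _
    rwa [range_modelWithCornersEuclideanHalfSpace] at this
  have hη : 0 ≤ (-outwardNormal g x) 0 := by
    have := (metricMatrix_posSemidef g x y₀).inv.diag_nonneg (i := 0)
    simp only [outwardNormal, PiLp.neg_apply, neg_div, neg_neg]
    exact div_nonneg this (Real.sqrt_nonneg _)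
  have hcone : -outwardNormal g x ∈ posTangentConeAt (Set.range (𝓡∂ n)) y₀ := by
    refine mem_posTangentConeAt_of_segment_subset ?_
    have hconv : Convex ℝ (Set.range (𝓡∂ n)) := (𝓡∂ n).convex_range
    refine hconv.segment_subset (Set.mem_range_self _) ?_
    rw [range_modelWithCornersEuclideanHalfSpace]
    exact add_nonneg hy₀ hη
  have := (isLocalMaxOn_comp_extChartAt_symm (n := n) h).fderivWithin_nonpos hcone
  rw [map_neg, neg_nonpos] at this
  rw [normalDeriv, hu.mfderiv]
  exact this

end YamabeBoundary

theorem proposition3p1 (n : ℕ) [NeZero n] (hn : 3 ≤ n)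
    {M : Type*} [TopologicalSpace M] [T2Space M] [SecondCountableTopology M]
    [ChartedSpace (EuclideanHalfSpace n) M] [IsManifold (𝓡∂ n) ∞ M]
    (g : YamabeBoundary.Metric n M)
    (hh : ∀ x ∈ (𝓡∂ n).boundary M, 0 < YamabeBoundary.meanCurvature g x)
    (M₁ N : Set M) (hM₁ : YamabeBoundary.IsCompactPiece n M₁ N)
    (lam γ : ℝ) (hlam : 0 < lam) (hγ : 0 < γ)
    (u : M → ℝ)
    (hu1 : ContMDiffOn (𝓡∂ n) 𝓘(ℝ, ℝ) 1 u M₁)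
    (hu2 : ContMDiffOn (𝓡∂ n) 𝓘(ℝ, ℝ) 2 u (interior M₁ ∩ (𝓡∂ n).interior M))
    (hL : ∀ x ∈ interior M₁ ∩ (𝓡∂ n).interior M, 0 ≤ YamabeBoundary.opL g lam u x)
    (hB : ∀ x ∈ (𝓡∂ n).boundary M, YamabeBoundary.opB g γ u x ≤ 0)
    (hN : ∀ x ∈ N, u x ≤ 0) :
    ∀ x ∈ M₁, u x ≤ 0 := by
  intro x hx
  obtain ⟨p, hp, hmax⟩ := hM₁.isCompact.exists_isMaxOn ⟨x, hx⟩ hu1.continuousOn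
  refine (hmax hx).trans ?_
  by_contra! hpos
  -- The interior is taken in `M`, so `p` may still lie on `∂M`.
  have hpi : p ∈ interior M₁ := by
    by_contra hpi
    refine hpos.not_ge (hN p ?_)
    rw [← hM₁.frontier_eq]
    exact ⟨subset_closure hp, hpi⟩
  have hnhds : M₁ ∈ 𝓝 p := mem_interior_iff_mem_nhds.mp hpi
  have hloc : IsLocalMax u p := hmax.isLocalMax hnhds
  rcases (𝓡∂ n).isInteriorPoint_or_isBoundaryPoint p with hint | hbd
  · have hopen : IsOpen (interior M₁ ∩ (𝓡∂ n).interior M) :=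
      isOpen_interior.inter ((𝓡∂ n).isOpen_interior (n := ∞) (by simp))
    have hlap := YamabeBoundary.laplacian_nonpos_of_isLocalMax g hint
      (hu2.contMDiffAt (hopen.mem_nhds ⟨hpi, hint⟩)) hloc
    have h := hL p ⟨hpi, hint⟩
    rw [YamabeBoundary.opL] at h
    have := mul_pos hlam hpos
    linarith
  · have hder := YamabeBoundary.normalDeriv_nonneg_of_isLocalMax g
      ((hu1.contMDiffAt hnhds).mdifferentiableAt (by simp)) hloc
    have h := hB p hbd
    rw [YamabeBoundary.opB] at h
    have hn' : (3 : ℝ) ≤ n := by exact_mod_cast hn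
    have hcoef : 0 < ((n : ℝ) - 2) / 2 * YamabeBoundary.meanCurvature g p + γ :=
      add_pos (mul_pos (by linarith) (hh p hbd)) hγ
    have := mul_pos hcoef hpos
    linarith
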